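/- Let $\mathcal E$ be a sphere of radius $r>0$ in three-dimensional Euclidean space, contained in the closed ball bounded by a sphere $\mathcal B$ of radius $R>0$, and let $d$ be the distance between the centres of $\mathcal E$ and $\mathcal B$. Then there exists a (nondegenerate) tetrahedron circumscribed about $\mathcal E$ and inscribed in $\mathcal B$, that is, a tetrahedron whose inscribed sphere (insphere) is $\mathcal E$ and whose circumscribed sphere (circumsphere) is $\mathcal B$, if and only if $$d^2\le (R+r)(R-3r)$$ (the Grace–Danielsson inequality). This inequality implies $R\ge 3r$; consequently every tetrahedron with circumradius $R$ and inradius $r$ satisfies the three-dimensional Euler inequality $R\ge 3r$. -/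

import Mathlib

/-! Necessity: let `e` be a unit vector along the line of centres, `v i` the outward unit normals
and `l i` the barycentric weights of the incenter. Cauchy–Schwarz between the parts of `v i` and
`s.points i - O` orthogonal to `e` makes a quadratic in `x` nonnegative for each vertex. Its
`l`-weighted average involves only `R`, `r`, `d`, and the discriminant condition is `(n - 1)² r² ≤
(R - r)² - d²`, which factors as claimed.

Sufficiency: a tetrahedron symmetric under a half-turn about the line of centres is written down,
with two opposite edges perpendicular to that line. The sine of the angle between them must be `2r /
√((R - r)² - d²)`, and the inequality says that this is at most 1. Euler's inequality follows from
`0 ≤ d²`. -/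

open Finset in
/-- In terms of unit normals `v i` to the faces, the vertices of a simplex lie at the levels
`r` and `r - h i`, seen from the incenter. -/
theorem Affine.Simplex.exists_unit_normals {E : Type*} [NormedAddCommGroup E]
    [InnerProductSpace ℝ E] {n : ℕ} [NeZero n] (s : Affine.Simplex ℝ E n) :
    ∃ (l h : Fin (n + 1) → ℝ) (v : Fin (n + 1) → E),
      (∀ i, 0 < l i) ∧ ∑ i, l i = 1 ∧ ∑ i, l i • s.points i = s.incenter ∧
      (∀ i, l i * h i = s.inradius) ∧ (∀ i, ‖v i‖ = 1) ∧
      ∀ i j, inner ℝ (v i) (s.points j - s.incenter) =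
        s.inradius - if j = i then h i else 0 := by
  have hsum : ∑ i, s.excenterWeights ∅ i = 1 :=
    s.sum_excenterWeights_eq_one_iff.2 s.excenterExists_empty
  have hself (i) : s.signedInfDist i (s.points i) = s.height i := by
    rw [s.signedInfDist_apply_self]
    simp [Affine.Simplex.height, Affine.Simplex.altitudeFoot, dist_eq_norm_vsub]
  refine ⟨s.excenterWeights ∅, s.height,
    fun i => -NormedSpace.normalize (s.points i -ᵥ
      EuclideanGeometry.orthogonalProjection (affineSpan ℝ (s.points '' {i}ᶜ)) (s.points i)),
    s.excenterWeights_empty_pos, hsum, ?_, ?_, ?_, ?_⟩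
  · rw [s.incenter_eq_affineCombination,
      Finset.affineCombination_eq_linear_combination _ _ _ hsum]
  · intro i
    rw [← s.signedInfDist_incenter i, s.incenter_eq_affineCombination,
      s.signedInfDist_affineCombination i hsum]
    simp [Affine.Simplex.height, Affine.Simplex.altitudeFoot, dist_eq_norm_vsub]
  · intro i
    rw [norm_neg, NormedSpace.norm_normalize_eq_one_iff, vsub_ne_zero]
    intro h
    have h0 := s.height_pos i
    rw [← hself, Affine.Simplex.signedInfDist, AffineSubspace.signedInfDist_apply_self, ← h] at h0
    simp at h0
  · intro i j
    have key : inner ℝ (NormedSpace.normalize (s.points i -ᵥ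
        EuclideanGeometry.orthogonalProjection (affineSpan ℝ (s.points '' {i}ᶜ)) (s.points i)))
        (s.points j - s.incenter) =
        s.signedInfDist i (s.points j) - s.signedInfDist i s.incenter := by
      rw [Affine.Simplex.signedInfDist, AffineSubspace.signedInfDist_def,
        signedDist_apply_apply, signedDist_apply_apply, ← inner_sub_right, vsub_sub_vsub_cancel_right]
      rfl
    rw [inner_neg_left, key, s.signedInfDist_incenter]
    split_ifs with hij
    · subst hij
      rw [hself]
      ring
    · rw [s.signedInfDist_apply_of_ne hij]
      simp

theorem exists_norm_eq_one_sub_eq_dist_smul {E : Type*} [NormedAddCommGroup E] [NormedSpace ℝ E]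
    [Nontrivial E] (O I : E) : ∃ e : E, ‖e‖ = 1 ∧ I - O = dist O I • e := by
  rcases eq_or_ne I O with heq | heq
  · obtain ⟨e, he⟩ := exists_norm_eq E zero_le_one
    exact ⟨e, he, by simp [heq]⟩
  · have : dist O I ≠ 0 := by simpa [eq_comm] using heq
    refine ⟨(dist O I)⁻¹ • (I - O), ?_, by rw [smul_inv_smul₀ this]⟩
    rw [norm_smul, ← dist_eq_norm, dist_comm I, norm_inv, Real.norm_of_nonneg dist_nonneg]
    exact inv_mul_cancel₀ this

/-! ### Necessity: averaging Cauchy–Schwarz over the vertices -/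

/-- The Grace–Danielsson inequality, in every dimension. -/
theorem Affine.Simplex.dist_circumcenter_incenter_sq_le {E : Type*} [NormedAddCommGroup E]
    [InnerProductSpace ℝ E] [Nontrivial E] {n : ℕ} [NeZero n] (s : Affine.Simplex ℝ E n)
    (hs : affineSpan ℝ (Set.range s.points) = ⊤) :
    dist s.circumcenter s.incenter ^ 2 ≤
      (s.circumradius + (n - 2) * s.inradius) * (s.circumradius - n * s.inradius) := by
  obtain ⟨l, h, v, hl, hsum, hI, hlh, hv, hvp⟩ := s.exists_unit_normals
  set r := s.inradius
  set R := s.circumradius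
  set I := s.incenter
  set O := s.circumcenter
  set d := dist O I
  obtain ⟨e, he, hd⟩ : ∃ e : E, ‖e‖ = 1 ∧ I - O = d • e :=
    exists_norm_eq_one_sub_eq_dist_smul O I
  have hee : inner ℝ e e = (1 : ℝ) := by rw [real_inner_self_eq_norm_sq, he, one_pow]
  -- Barycentric coordinates of `I + e` give `l i * ⟪v i, e⟫ = r * (l i - w i)`, so every average
  -- below can be evaluated.
  have hw : ∃ w : Fin (n + 1) → ℝ, ∑ i, w i = 1 ∧ ∑ i, w i • s.points i = I + e := by
    have : I + e ∈ affineSpan ℝ (Set.range s.points) := by rw [hs]; trivial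
    obtain ⟨w, hw, hw'⟩ := eq_affineCombination_of_mem_affineSpan_of_fintype this
    exact ⟨w, hw, by rw [hw', Finset.affineCombination_eq_linear_combination _ _ _ hw]⟩
  obtain ⟨w, hw1, hw2⟩ := hw
  have hsub (f : E) (c : Fin (n + 1) → ℝ) (hc : ∑ i, c i = 1) :
      ∑ i, c i * inner ℝ f (s.points i - I) = inner ℝ f (∑ i, c i • s.points i - I) := by
    simp only [inner_sub_right, inner_sum, inner_smul_right, mul_sub, Finset.sum_sub_distrib,
      ← Finset.sum_mul, hc, one_mul]
  have hve (i) : inner ℝ (v i) e = r - w i * h i := by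
    have := hsub (v i) w hw1
    rw [hw2, add_sub_cancel_left] at this
    rw [← this]
    simp [hvp, mul_sub, ← Finset.sum_mul, hw1]
  let a : Fin (n + 1) → ℝ := fun i => inner ℝ (v i) e
  let b : Fin (n + 1) → ℝ := fun i => inner ℝ e (s.points i - I)
  have ha : ∑ i, l i * a i = 0 := by
    simp only [a, hve, mul_sub, Finset.sum_sub_distrib, ← Finset.sum_mul, hsum]
    have : ∀ i, l i * (w i * h i) = w i * r := fun i => by rw [← hlh i]; ring
    simp only [this, ← Finset.sum_mul, hw1]; ring
  have hb : ∑ i, l i * b i = 0 := by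
    simp only [b, hsub e l hsum, hI, sub_self, inner_zero_right]
  have hab : ∑ i, l i * (a i * b i) = -r := by
    have h1 : ∀ i, l i * (a i * b i) = r * (l i * b i) - r * (w i * b i) := fun i => by
      simp only [a, hve]; rw [← hlh i]; ring
    have h2 : ∑ i, w i * b i = 1 := by
      simp only [b, hsub e w hw1, hw2, add_sub_cancel_left, hee]
    simp only [h1, Finset.sum_sub_distrib, ← Finset.mul_sum, hb, h2]; ring
  have hc : ∑ i, l i * inner ℝ (v i) (s.points i - I) = -n * r := by
    have : ∀ i, l i * inner ℝ (v i) (s.points i - I) = l i * r - r := fun i => by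
      rw [hvp, if_pos rfl, ← hlh i]; ring
    simp only [this, Finset.sum_sub_distrib, ← Finset.sum_mul, hsum]
    simp
    ring
  -- The Cauchy–Schwarz bound `(1 - α²)(R² - β²)` is split as `(R - β)(1 - α)` times `(R + β)(1 +
  -- α)`, so that averaging needs only the sums `ha`, `hb`, `hab`, `hc`.
  have hpoint (x : ℝ) (i) : 0 ≤ (R - (b i + d)) * (1 - a i) * (x * x)
      + 2 * (inner ℝ (v i) (s.points i - I) + d * a i - (b i + d) * a i) * x
      + (R + (b i + d)) * (1 + a i) := by
    set p := s.points i - O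
    have hp : s.points i - I = p - d • e := by rw [← hd]; simp [p]
    have hpR : ‖p‖ = R := by
      rw [← dist_eq_norm]; exact s.dist_circumcenter_eq_circumradius i
    have hbi : b i + d = inner ℝ e p := by
      simp only [b]; rw [hp, inner_sub_right, inner_smul_right, hee]; ring
    have hvi : inner ℝ (v i) (s.points i - I) + d * a i = inner ℝ (v i) p := by
      simp only [a, hp, inner_sub_right, inner_smul_right]; ring
    rw [hbi, hvi]
    have hai : |a i| ≤ 1 := by
      simpa [hv, he] using abs_real_inner_le_norm (v i) e
    have hpi : |inner ℝ e p| ≤ R := by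
      simpa [hpR, he] using abs_real_inner_le_norm e p
    set α := a i
    set β : ℝ := inner ℝ e p
    have hcs := real_inner_mul_inner_self_le (v i - α • e) (p - β • e)
    have e1 : inner ℝ (v i - α • e) (p - β • e) = inner ℝ (v i) p - β * α := by
      simp only [inner_sub_left, inner_sub_right, inner_smul_left, inner_smul_right, hee]
      simp only [α, a, β]; simp; ring
    have e2 : inner ℝ (v i - α • e) (v i - α • e) = 1 - α ^ 2 := by
      simp only [inner_sub_left, inner_sub_right, inner_smul_left, inner_smul_right, hee,
        real_inner_self_eq_norm_sq, hv, real_inner_comm (v i) e]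
      simp only [α, a]; simp; ring
    have e3 : inner ℝ (p - β • e) (p - β • e) = R ^ 2 - β ^ 2 := by
      simp only [inner_sub_left, inner_sub_right, inner_smul_left, inner_smul_right, hee,
        real_inner_self_eq_norm_sq, hpR, real_inner_comm e p]
      simp only [β]; simp; ring
    rw [e1, e2, e3] at hcs
    set γ : ℝ := inner ℝ (v i) p - β * α
    obtain ⟨ha1, ha2⟩ := abs_le.1 hai
    obtain ⟨hp1, hp2⟩ := abs_le.1 hpi
    have hA : 0 ≤ (R - β) * (1 - α) := mul_nonneg (by linarith) (by linarith)
    have hD : 0 ≤ (R + β) * (1 + α) := mul_nonneg (by linarith) (by linarith)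
    have hAD : γ * γ ≤ ((R - β) * (1 - α)) * ((R + β) * (1 + α)) := hcs.trans_eq (by ring)
    generalize (R - β) * (1 - α) = A at *
    generalize (R + β) * (1 + α) = D at *
    rcases hA.eq_or_lt with rfl | hA
    · have : γ = 0 := by nlinarith
      rw [this]; simpa using hD
    · have : 0 ≤ A * (A * (x * x) + 2 * γ * x + D) := by nlinarith [sq_nonneg (A * x + γ)]
      exact nonneg_of_mul_nonneg_right this hA
  have hquad (x : ℝ) : 0 ≤ (R - d - r) * (x * x) + (-2 * (n - 1) * r) * x + (R + d - r) := by
    have h0 := Finset.sum_nonneg fun i (_ : i ∈ Finset.univ) => mul_nonneg (hl i).le (hpoint x i)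
    have h1 : ∀ i, l i * ((R - (b i + d)) * (1 - a i) * (x * x)
        + 2 * (inner ℝ (v i) (s.points i - I) + d * a i - (b i + d) * a i) * x
        + (R + (b i + d)) * (1 + a i)) =
        l i * ((R - d) * (x * x) + (R + d)) + l i * b i * (1 - x * x)
        + l i * a i * ((R + d) - (R - d) * (x * x)) + l i * (a i * b i) * (x * x - 2 * x + 1)
        + l i * inner ℝ (v i) (s.points i - I) * (2 * x) := fun i => by ring
    simp only [h1, Finset.sum_add_distrib, ← Finset.sum_mul, ha, hb, hab, hc, hsum] at h0
    linarith
  have := discrim_le_zero hquad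
  rw [discrim] at this
  nlinarith

theorem three_mul_le_of_dist_sq_le {R r d : ℝ} (h : d ^ 2 ≤ (R + r) * (R - 3 * r))
    (hRr : 0 < R + r) : 3 * r ≤ R :=
  sub_nonneg.1 (nonneg_of_mul_nonneg_right ((sq_nonneg d).trans h) hRr)

/-! ### Sufficiency: an explicit tetrahedron -/

/-- Coordinates of a tetrahedron with vertices `(s, ± p C, ± p S)`, `(t, ± q C, ∓ q S)` and of the
unit normals `(α, ± β S, ∓ β C)`, `(α', ± β' S, ± β' C)` to its faces, all of which are at distance
`r` from `(d, 0, 0)`. -/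
theorem exists_disphenoid_parameters {R r d : ℝ} (hr : 0 < r) (hR : 0 < R) (hd : 0 ≤ d)
    (h : d ^ 2 ≤ (R + r) * (R - 3 * r)) :
    ∃ s t p q C S α β α' β' : ℝ, C ^ 2 + S ^ 2 = 1 ∧ s ^ 2 + p ^ 2 = R ^ 2 ∧
      t ^ 2 + q ^ 2 = R ^ 2 ∧ α ^ 2 + β ^ 2 = 1 ∧ α' ^ 2 + β' ^ 2 = 1 ∧
      (s - d) * α = r ∧ (t - d) * α' = r ∧ (t - d) * α + 2 * (C * S) * (q * β) = r ∧
      (s - d) * α' + 2 * (C * S) * (p * β') = r ∧ 0 < C * S * (q * β) ∧ 0 < C * S * (p * β') := by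
  have h3 : 3 * r ≤ R := three_mul_le_of_dist_sq_le h (add_pos hR hr)
  -- The hypothesis rewritten as `2r ≤ D`, which allows `2r / D` to be a sine.
  have hD : 4 * r ^ 2 ≤ (R - r) ^ 2 - d ^ 2 := by linarith
  set D := √((R - r) ^ 2 - d ^ 2)
  have hDsq : D ^ 2 = (R - r) ^ 2 - d ^ 2 := Real.sq_sqrt (by nlinarith)
  have hD0 : 0 ≤ D := Real.sqrt_nonneg _
  have hD2 : 2 * r ≤ D := by nlinarith
  have hDpos : 0 < D := by linarith
  have hdR : d < R - r := by nlinarith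
  -- the half angle
  obtain ⟨C, S, hCS, hk⟩ : ∃ C S : ℝ, C ^ 2 + S ^ 2 = 1 ∧ C * S * D = r := by
    refine ⟨Real.cos (Real.arcsin (2 * r / D) / 2), Real.sin (Real.arcsin (2 * r / D) / 2),
      Real.cos_sq_add_sin_sq _, ?_⟩
    have h1 := Real.sin_two_mul (Real.arcsin (2 * r / D) / 2)
    rw [mul_div_cancel₀ _ two_ne_zero, Real.sin_arcsin
      (by have : 0 ≤ 2 * r / D := by positivity
          linarith) ((div_le_one hDpos).2 hD2)] at h1
    field_simp at h1
    linarith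
  -- With `ρ² = r / R`, the numbers `s, t = m ± ρM` are the roots of `(x - d)² = r² + ρ²(R² - x²)`.
  -- This equation makes the normals below have length one.
  obtain ⟨m, hm⟩ : ∃ m, m * (R + r) = R * d := ⟨R * d / (R + r), by field_simp⟩
  have hm0 : 0 ≤ m := by
    by_contra! hlt
    nlinarith [mul_pos (neg_pos.2 hlt) (add_pos hR hr), mul_nonneg hR.le hd]
  have hmd : m ≤ d := by nlinarith [mul_nonneg hr.le hd]
  have hmR : m < R := by linarith
  obtain ⟨ρ, hρ, hρR⟩ : ∃ ρ, 0 < ρ ∧ ρ ^ 2 * R = r :=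
    ⟨√(r / R), by positivity, by rw [Real.sq_sqrt (by positivity)]; field_simp⟩
  obtain ⟨M, hM, hMsq⟩ : ∃ M, 0 < M ∧ M ^ 2 = R ^ 2 - m ^ 2 := by
    have : 0 < R ^ 2 - m ^ 2 := by nlinarith
    exact ⟨√(R ^ 2 - m ^ 2), by positivity, Real.sq_sqrt this.le⟩
  have hρ1 : ρ ^ 2 < 1 := by nlinarith
  have hd' : d = m * (1 + ρ ^ 2) := by
    have : R * (d - m * (1 + ρ ^ 2)) = 0 := by linear_combination -hm - m * hρR
    rcases mul_eq_zero.1 this with h | h <;> linarith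
  have hq : 0 < R ^ 2 - (m - ρ * M) ^ 2 := by
    have : R ^ 2 - (m - ρ * M) ^ 2 = (1 - ρ ^ 2) * M ^ 2 + 2 * m * (ρ * M) := by
      linear_combination -hMsq
    rw [this]
    have := sub_pos.2 hρ1
    positivity
  have hpq : (R ^ 2 - (m + ρ * M) ^ 2) * (R ^ 2 - (m - ρ * M) ^ 2) = M ^ 2 * D ^ 2 := by
    rw [hDsq, hd', ← hρR]
    have : R ^ 2 = M ^ 2 + m ^ 2 := by linarith
    linear_combination (R ^ 2 - m ^ 2 - ρ ^ 4 * M ^ 2) * this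
  have hp : 0 < R ^ 2 - (m + ρ * M) ^ 2 := by
    refine pos_of_mul_pos_left ?_ hq.le
    rw [hpq]; positivity
  obtain ⟨p, hp0, hpsq⟩ : ∃ p, 0 < p ∧ p ^ 2 = R ^ 2 - (m + ρ * M) ^ 2 :=
    ⟨√_, Real.sqrt_pos.2 hp, Real.sq_sqrt hp.le⟩
  obtain ⟨q, hq0, hqsq⟩ : ∃ q, 0 < q ∧ q ^ 2 = R ^ 2 - (m - ρ * M) ^ 2 :=
    ⟨√_, Real.sqrt_pos.2 hq, Real.sq_sqrt hq.le⟩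
  have hpqM : p * q = M * D := by
    refine (pow_left_inj₀ (by positivity) (by positivity) two_ne_zero).1 ?_
    rw [mul_pow, mul_pow, hpsq, hqsq, hpq]
  have hsd : 0 < m + ρ * M - d := by
    have h1 : m * d < R * R := mul_lt_mul'' hmR (by linarith) hm0 hd
    have h2 : (ρ * m) ^ 2 < M ^ 2 := by
      rw [hMsq]
      linear_combination h1 - m * hd'
    have h3 := mul_pos hρ (sub_pos.2 (lt_of_pow_lt_pow_left₀ 2 hM.le h2))
    linear_combination h3 + hd'
  have htd : 0 < d - (m - ρ * M) := by linarith [mul_pos hρ hM]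
  have es : (m + ρ * M - d) ^ 2 = r ^ 2 + ρ ^ 2 * p ^ 2 := by
    rw [hpsq, hd', ← hρR]
    linear_combination ρ ^ 2 * (1 + ρ ^ 2) * hMsq
  have et : (d - (m - ρ * M)) ^ 2 = r ^ 2 + ρ ^ 2 * q ^ 2 := by
    rw [hqsq, hd', ← hρR]
    linear_combination ρ ^ 2 * (1 + ρ ^ 2) * hMsq
  have hCSpos : 0 < C * S := pos_of_mul_pos_left (hk ▸ hr) hD0
  -- Both conditions pairing a normal with the opposite edge reduce to this identity, because `s - t
  -- = 2ρM`.
  have hmain : C * S * (p * q) = r * M := by rw [hpqM]; linear_combination M * hk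
  refine ⟨m + ρ * M, m - ρ * M, p, q, C, S, r / (m + ρ * M - d), ρ * p / (m + ρ * M - d),
    -(r / (d - (m - ρ * M))), ρ * q / (d - (m - ρ * M)), hCS, by linarith, by linarith,
    ?_, ?_, ?_, ?_, ?_, ?_, by positivity, by positivity⟩
  · field_simp; linarith
  · field_simp; linarith
  · field_simp
  · field_simp; ring
  · field_simp; linear_combination 2 * ρ * hmain
  · field_simp; linear_combination 2 * ρ * hmain

/-! ### Recognising the insphere from the face normals -/

open Finset in
/-- If all the faces of a full-dimensional simplex, with outward unit normals `v i`, are at distance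
`r` from the point `c` inside it, then `c` and `r` are its incenter and inradius. -/
theorem Affine.Simplex.insphere_eq_of_unit_normals {E : Type*} [NormedAddCommGroup E]
    [InnerProductSpace ℝ E] {n : ℕ} [NeZero n] (s : Affine.Simplex ℝ E n)
    (hs : affineSpan ℝ (Set.range s.points) = ⊤) {c : E} {r : ℝ} (hr : 0 < r)
    {v : Fin (n + 1) → E} (hv : ∀ i, ‖v i‖ = 1)
    (hne : ∀ i j, j ≠ i → inner ℝ (v i) (s.points j - c) = r)
    (hlt : ∀ i, inner ℝ (v i) (s.points i - c) < r) : s.insphere = ⟨c, r⟩ := by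
  -- Pairing with `v i` isolates the `i`-th barycentric coordinate: times the height, it is the
  -- signed distance to the face.
  have hcomb (x : E) : ∃ w : Fin (n + 1) → ℝ, ∑ i, w i = 1 ∧
      Finset.univ.affineCombination ℝ s.points w = x ∧
      ∀ i, w i * (r - inner ℝ (v i) (s.points i - c)) = r - inner ℝ (v i) (x - c) := by
    have : x ∈ affineSpan ℝ (Set.range s.points) := by rw [hs]; trivial
    obtain ⟨w, hw, hw'⟩ := eq_affineCombination_of_mem_affineSpan_of_fintype this
    refine ⟨w, hw, hw'.symm, fun i => ?_⟩
    rw [Finset.affineCombination_eq_linear_combination _ _ _ hw] at hw'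
    have h1 : r - inner ℝ (v i) (x - c) = ∑ j, w j * (r - inner ℝ (v i) (s.points j - c)) := by
      simp only [hw', mul_sub, inner_sub_right, inner_sum, inner_smul_right, sum_sub_distrib,
        ← sum_mul, hw]
      ring
    rw [h1, sum_eq_single i (fun j _ hj => by rw [hne i j hj, sub_self, mul_zero]) (by simp)]
  have hheight (i) : s.height i = r - inner ℝ (v i) (s.points i - c) := by
    set g := r - inner ℝ (v i) (s.points i - c) with hg
    have hg0 : 0 < g := sub_pos.2 (hlt i)
    have hfoot : s.altitudeFoot i = s.points i + g • v i := by
      rw [Affine.Simplex.altitudeFoot, Affine.Simplex.orthogonalProjectionSpan]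
      refine EuclideanGeometry.coe_orthogonalProjection_eq_iff_mem.2 ⟨?_, ?_⟩
      · obtain ⟨w, hw1, hw2, hw3⟩ := hcomb (s.points i + g • v i)
        have hi := hw3 i
        rw [← hg, add_sub_right_comm, inner_add_right, inner_smul_right,
          real_inner_self_eq_norm_sq, hv] at hi
        have hi0 : w i = 0 := by
          refine (mul_eq_zero.1 (hi.trans ?_)).resolve_right hg0.ne'
          rw [hg]; ring
        rw [← hw2]
        exact (s.affineCombination_mem_affineSpan_faceOpposite_iff hw1).2 hi0
      · rw [direction_affineSpan, vectorSpan_def, s.range_faceOpposite_points,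
          Submodule.mem_orthogonal]
        intro u hu
        induction hu using Submodule.span_induction with
        | mem u hu =>
          obtain ⟨_, ⟨j, hj, rfl⟩, _, ⟨k, hk, rfl⟩, rfl⟩ := hu
          change inner ℝ (s.points j - s.points k) (s.points i - (s.points i + g • v i)) = 0
          rw [sub_add_cancel_left, inner_neg_right, inner_smul_right,
            ← sub_sub_sub_cancel_right _ _ c, real_inner_comm, inner_sub_right,
            hne i j hj, hne i k hk, sub_self, mul_zero, neg_zero]
        | zero => exact inner_zero_left _
        | add x y _ _ hx hy => rw [inner_add_left, hx, hy, add_zero]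
        | smul a x _ hx => rw [inner_smul_left, hx, mul_zero]
    rw [Affine.Simplex.height, hfoot, dist_eq_norm, sub_add_cancel_left, norm_neg, norm_smul, hv,
      Real.norm_of_nonneg hg0.le, mul_one]
  obtain ⟨w, hw1, hw2, hw3⟩ := hcomb c
  -- The incenter weights are proportional to inverse heights, and the coordinates of `c` are `r`
  -- over the heights.
  have hw (i) : s.excenterWeightsUnnorm ∅ i = r⁻¹ * w i := by
    have := hw3 i
    rw [← hheight, sub_self, inner_zero_right, sub_zero] at this
    have := s.height_pos i
    rw [s.excenterWeightsUnnorm_empty_apply]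
    field_simp
    linarith
  have hsum : ∑ i, s.excenterWeightsUnnorm ∅ i = r⁻¹ := by
    simp only [hw, ← mul_sum, hw1, mul_one]
  have hwt : s.excenterWeights ∅ = w := by
    ext i
    rw [Affine.Simplex.excenterWeights, hsum, Pi.smul_apply, hw, inv_inv, smul_eq_mul,
      mul_inv_cancel_left₀ hr.ne']
  rw [Affine.Simplex.insphere, Affine.Simplex.exsphere, hwt, hw2, hsum, inv_inv, abs_of_pos hr]

/-- Points are affinely independent if each of them lies off a hyperplane through the others. -/
theorem affineIndependent_of_inner {E ι : Type*} [NormedAddCommGroup E] [InnerProductSpace ℝ E]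
    [Fintype ι] {p v : ι → E} {c : E} {r : ℝ} (hne : ∀ i j, j ≠ i → inner ℝ (v i) (p j - c) = r)
    (hlt : ∀ i, inner ℝ (v i) (p i - c) < r) : AffineIndependent ℝ p := by
  rw [affineIndependent_iff_of_fintype]
  intro w hw h i
  rw [Finset.univ.weightedVSub_eq_linear_combination hw] at h
  have h1 : ∑ j, w j * (inner ℝ (v i) (p j - c) - r) = inner ℝ (v i) (∑ j, w j • p j) := by
    simp only [mul_sub, inner_sub_right, inner_sum, inner_smul_right, Finset.sum_sub_distrib,
      ← Finset.sum_mul, hw]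
    ring
  rw [h, inner_zero_right, Finset.sum_eq_single i
    (fun j _ hj => by rw [hne i j hj, sub_self, mul_zero]) (by simp)] at h1
  exact (mul_eq_zero.1 h1).resolve_right (sub_neg.2 (hlt i)).ne

/-- The first axis points from `O` to `I`; the half-turn about it swaps the vertices in the pairs 0,
1 and 2, 3. -/
theorem exists_simplex_insphere_eq_circumsphere_eq {E : Type*} [NormedAddCommGroup E]
    [InnerProductSpace ℝ E] [FiniteDimensional ℝ E] (hE : Module.finrank ℝ E = 3) {O I : E}
    {R r : ℝ} (hr : 0 < r) (hR : 0 < R) (h : dist O I ^ 2 ≤ (R + r) * (R - 3 * r)) :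
    ∃ T : Affine.Simplex ℝ E 3, T.insphere = ⟨I, r⟩ ∧ T.circumsphere = ⟨O, R⟩ := by
  have : Nontrivial E := Module.nontrivial_of_finrank_pos (R := ℝ) (by rw [hE]; norm_num)
  obtain ⟨s, t, p, q, C, S, α, β, α', β', hCS, hsp, htq, hαβ, hαβ', hsα, htα, htβ, hsβ, hpos,
    hpos'⟩ := exists_disphenoid_parameters hr hR dist_nonneg h
  obtain ⟨e, he, hd⟩ := exists_norm_eq_one_sub_eq_dist_smul O I
  obtain ⟨b, hb⟩ := Orthonormal.exists_orthonormalBasis_extension_of_card_eq (𝕜 := ℝ)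
    (ι := Fin 3) (by simpa using hE) (v := fun _ => e) (s := {0})
    ⟨fun _ => he, fun i j hij => (hij (Subsingleton.elim i j)).elim⟩
  have hb0 : b 0 = e := hb 0 rfl
  set d := dist O I
  let P (x y z : ℝ) : E := x • b 0 + y • b 1 + z • b 2
  have hP (x y z x' y' z' : ℝ) :
      inner ℝ (P x y z) (P x' y' z') = x * x' + y * y' + z * z' := by
    simp only [P, inner_add_left, inner_add_right, inner_smul_left, inner_smul_right,
      b.inner_eq_ite]
    simp
    ring
  have hnorm {x y z a : ℝ} (ha : 0 ≤ a) (hx : x ^ 2 + y ^ 2 + z ^ 2 = a ^ 2) :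
      ‖P x y z‖ = a := by
    rw [← pow_left_inj₀ (norm_nonneg _) ha two_ne_zero, ← real_inner_self_eq_norm_sq, hP]
    linarith
  let X : Fin 4 → E := ![P s (p * C) (p * S), P s (-(p * C)) (-(p * S)),
    P t (q * C) (-(q * S)), P t (-(q * C)) (q * S)]
  let v : Fin 4 → E := ![P α' (-(β' * S)) (-(β' * C)), P α' (β' * S) (β' * C),
    P α (-(β * S)) (β * C), P α (β * S) (-(β * C))]
  have hsub (x y z : ℝ) : O + P x y z - I = P (x - d) y z := by
    rw [← sub_sub_cancel O I, ← neg_sub I O, hd, ← hb0]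
    simp only [P, sub_smul]
    abel
  have hv (i) : ‖v i‖ = 1 := by
    fin_cases i <;> refine hnorm zero_le_one ?_
    · linear_combination hαβ' + β' ^ 2 * hCS
    · linear_combination hαβ' + β' ^ 2 * hCS
    · linear_combination hαβ + β ^ 2 * hCS
    · linear_combination hαβ + β ^ 2 * hCS
  have hne (i j) (hij : j ≠ i) : inner ℝ (v i) (O + X j - I) = r := by
    fin_cases i <;> fin_cases j <;> first | exact (hij rfl).elim | skip
    all_goals
      simp only [v, X, Fin.reduceFinMk, Fin.zero_eta, Fin.mk_one, Fin.isValue,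
        Matrix.cons_val, hsub, hP]
      linarith
  -- The values are `r - 4CSpβ'` and `r - 4CSqβ`.
  have hlt (i) : inner ℝ (v i) (O + X i - I) < r := by
    fin_cases i
    all_goals
      simp only [v, X, Fin.reduceFinMk, Fin.zero_eta, Fin.mk_one, Fin.isValue,
        Matrix.cons_val, hsub, hP]
      linarith
  let T : Affine.Simplex ℝ E 3 := ⟨fun i => O + X i, affineIndependent_of_inner hne hlt⟩
  have hT : affineSpan ℝ (Set.range T.points) = ⊤ :=
    T.independent.affineSpan_eq_top_iff_card_eq_finrank_add_one.2 (by simp [hE])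
  refine ⟨T, T.insphere_eq_of_unit_normals hT hr hv hne hlt,
    (T.circumsphere_unique_dist_eq.2 ⟨O, R⟩ ⟨by rw [hT]; trivial, ?_⟩).symm⟩
  rintro _ ⟨i, rfl⟩
  rw [EuclideanGeometry.Sphere.mem_coe, EuclideanGeometry.mem_sphere, dist_eq_norm,
    add_sub_cancel_left]
  fin_cases i <;> refine hnorm hR.le ?_
  · linear_combination hsp + p ^ 2 * hCS
  · linear_combination hsp + p ^ 2 * hCS
  · linear_combination htq + q ^ 2 * hCS
  · linear_combination htq + q ^ 2 * hCS

theorem corollary2 :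
    -- Sphere `⟨I, r⟩` inside sphere `⟨O, R⟩`, with centre distance `dist O I`.
    (∀ (O I : EuclideanSpace ℝ (Fin 3)) (R r : ℝ), 0 < r → 0 < R →
      Metric.sphere I r ⊆ Metric.closedBall O R →
        -- The Grace–Danielsson criterion for a nested (nondegenerate) tetrahedron.
        ((∃ T : Affine.Simplex ℝ (EuclideanSpace ℝ (Fin 3)) 3,
            T.insphere = ⟨I, r⟩ ∧ T.circumsphere = ⟨O, R⟩) ↔
          dist O I ^ 2 ≤ (R + r) * (R - 3 * r)) ∧
        -- The Grace–Danielsson inequality implies `R ≥ 3 r`.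
        (dist O I ^ 2 ≤ (R + r) * (R - 3 * r) → 3 * r ≤ R)) ∧
    -- Euler's inequality in dimension three, for every tetrahedron.
    (∀ T : Affine.Simplex ℝ (EuclideanSpace ℝ (Fin 3)) 3,
      3 * T.inradius ≤ T.circumradius) := by
  have key (T : Affine.Simplex ℝ (EuclideanSpace ℝ (Fin 3)) 3) :
      dist T.circumcenter T.incenter ^ 2 ≤
        (T.circumradius + T.inradius) * (T.circumradius - 3 * T.inradius) := by
    have hT : affineSpan ℝ (Set.range T.points) = ⊤ :=
      T.independent.affineSpan_eq_top_iff_card_eq_finrank_add_one.2 (by simp)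
    have := T.dist_circumcenter_incenter_sq_le hT
    norm_num at this
    exact this
  refine ⟨fun O I R r hr hR _ => ⟨⟨?_, fun h =>
    exists_simplex_insphere_eq_circumsphere_eq (by simp) hr hR h⟩,
    fun h => three_mul_le_of_dist_sq_le h (by positivity)⟩,
    fun T => three_mul_le_of_dist_sq_le (key T) (add_pos T.circumradius_pos T.inradius_pos)⟩
  rintro ⟨T, hI, hO⟩
  have := key T
  rwa [← T.insphere_center, ← T.insphere_radius, ← T.circumsphere_center, ← T.circumsphere_radius,
    hI, hO] at this
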